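/- Throughout, a \emph{groupoid} is a locally compact Hausdorff topological groupoid $G$ whose range and source maps $r,s:G\to G^{(0)}$ onto the unit space are open. Its isotropy group at $u\in G^{(0)}$ is $G(u)=\{\gamma\in G: r(\gamma)=u=s(\gamma)\}$, and $G$ has \emph{abelian isotropy} if every $G(u)$ is abelian. The orbit space $G\backslash G^{(0)}$ is the quotient of $G^{(0)}$ by the relation $r(\gamma)\sim s(\gamma)$ $(\gamma\in G)$, with the quotient topology. Let $\Sigma_G$ be the set of closed subsets of $G$ that are subgroups of some $G(u)$, with the relative Fell topology (generated by the sets $\{S: S\cap K=\emptyset\}$ with $K\subset G$ compact and $\{S: S\cap O\neq\emptyset\}$ with $O\subset G$ open), and let $p_0:\Sigma_G\to G^{(0)}$ send a subgroup of $G(u)$ to $u$. Let $\pi(\gamma)=(r(\gamma),s(\gamma))$ and let $R_G=\pi(G)\subset G^{(0)}\times G^{(0)}$, a topological groupoid with the relative product topology and operations $(u,v)(v,w)=(u,w)$, $(u,v)^{-1}=(v,u)$. We say that \emph{$R_G$ acts continuously on $\Sigma_G$} if there is a continuous groupoid action of $R_G$ on $\Sigma_G$ with moment map $p_0$ such that \[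 \pi(\gamma)\cdot S=\gamma S\gamma^{-1}\qquad(\gamma\in G,\ S\in\Sigma_G,\ p_0(S)=s(\gamma)) \] (if $G$ has abelian isotropy this formula is well defined, so that only continuity is at issue). The groupoid $G$ is \emph{proper modulo its isotropy} if it has abelian isotropy, $G\backslash G^{(0)}$ is Hausdorff, and $R_G$ acts continuously on $\Sigma_G$. Groupoids $G$ and $H$ are \emph{equivalent} if there is a locally compact Hausdorff space $Z$ that is a free and proper left $G$-space with moment map $r_Z$ and a free and proper right $H$-space with moment map $s_Z$, such that the two actions commute, $r_Z$ is open and induces a homeomorphism of $Z/H$ onto $G^{(0)}$, and $s_Z$ is open and induces a homeomorphism of $G\backslash Z$ onto $H^{(0)}$. (Moment maps and actions are continuous; a left action is free if $\gamma\cdot z=z$ only for units $\gamma$, and proper if preimages of compact sets under $(\gamma,z)\mapsto(\gamma\cdot z,z)$ are compact; similarly for right actions.) \textbf{Theorem.} \begin{enumerate} \item[(1)] Let $G$ and $H$ be equivalent groupoids. Then $G$ is proper modulo its isotropy if and only if $H$ is proper modulo its isotropy. \item[(2)] Let $G$ be a groupoid with abelian isotropy, let $X$ be a locally compact Hausdorff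 space, let $f:X\to G^{(0)}$ be a continuous open surjection, and let \[ G[X]=\{(x,\gamma,y)\in X\times G\times X: f(x)=r(\gamma),\ s(\gamma)=f(y)\} \] be the blow-up, with the relative product topology, unit space $X$, $r(x,\gamma,y)=x$, $s(x,\gamma,y)=y$, $(x,\gamma,y)(y,\eta,z)=(x,\gamma\eta,z)$ and $(x,\gamma,y)^{-1}=(y,\gamma^{-1},x)$. Then $R_G$ acts continuously on $\Sigma_G$ if and only if $R_{G[X]}$ acts continuously on $\Sigma_{G[X]}$. \end{enumerate} -/

import Mathlib

open Set Topology TopologicalSpace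

universe u₁ u₂ u₃ u₄ u₅ u₆

/-- A topological groupoid with space of arrows `G` and unit space `U`. The unit space is kept as a
separate space, embedded in `G` by `unit`; since `r` is continuous and `r ∘ unit = id`, the topology
of `U` is the subspace topology that it receives from `G`. The product `γη` is defined exactly when
`s γ = r η`. -/
structure TopologicalGroupoid (G : Type u₁) (U : Type u₂)
    [TopologicalSpace G] [TopologicalSpace U] where
  /-- range map -/
  r : G → U
  /-- source map -/
  s : G → U
  /-- the unit at a point of the unit space -/
  unit : U → G
  /-- inversion -/
  inv : G → G
  /-- multiplication of composable arrows -/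
  mul : (γ η : G) → s γ = r η → G
  r_unit : ∀ u, r (unit u) = u
  s_unit : ∀ u, s (unit u) = u
  r_inv : ∀ γ, r (inv γ) = s γ
  s_inv : ∀ γ, s (inv γ) = r γ
  r_mul : ∀ γ η h, r (mul γ η h) = r γ
  s_mul : ∀ γ η h, s (mul γ η h) = s η
  mul_assoc : ∀ γ η ζ (h₁ : s γ = r η) (h₂ : s η = r ζ),
    mul (mul γ η h₁) ζ ((s_mul γ η h₁).trans h₂) = mul γ (mul η ζ h₂) (h₁.trans (r_mul η ζ h₂).symm)
  unit_mul : ∀ γ, mul (unit (r γ)) γ (s_unit (r γ)) = γ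
  mul_unit : ∀ γ, mul γ (unit (s γ)) (r_unit (s γ)).symm = γ
  mul_inv : ∀ γ, mul γ (inv γ) (r_inv γ).symm = unit (r γ)
  inv_mul : ∀ γ, mul (inv γ) γ (s_inv γ) = unit (s γ)
  continuous_r : Continuous r
  continuous_s : Continuous s
  continuous_unit : Continuous unit
  continuous_inv : Continuous inv
  continuous_mul : Continuous fun p : {p : G × G // s p.1 = r p.2} => mul p.1.1 p.1.2 p.2

/-- A continuous left action of a groupoid on a space `Z`, with continuous moment map;
`γ · z` is defined exactly when `s γ = moment z`. -/
structure LeftAction {G : Type u₁} {U : Type u₂} [TopologicalSpace G] [TopologicalSpace U]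
    (𝓖 : TopologicalGroupoid G U) (Z : Type u₅) [TopologicalSpace Z] where
  /-- moment map -/
  moment : Z → U
  /-- the action `γ · z` -/
  smul : (γ : G) → (z : Z) → 𝓖.s γ = moment z → Z
  moment_smul : ∀ γ z h, moment (smul γ z h) = 𝓖.r γ
  unit_smul : ∀ z, smul (𝓖.unit (moment z)) z (𝓖.s_unit (moment z)) = z
  mul_smul : ∀ γ η z (h₁ : 𝓖.s γ = 𝓖.r η) (h₂ : 𝓖.s η = moment z),
    smul (𝓖.mul γ η h₁) z ((𝓖.s_mul γ η h₁).trans h₂) =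
      smul γ (smul η z h₂) (h₁.trans (moment_smul η z h₂).symm)
  continuous_moment : Continuous moment
  continuous_smul :
    Continuous fun p : {p : G × Z // 𝓖.s p.1 = moment p.2} => smul p.1.1 p.1.2 p.2

/-- A continuous right action of a groupoid on a space `Z`, with continuous moment map;
`z · η` is defined exactly when `moment z = r η`. -/
structure RightAction {H : Type u₁} {V : Type u₂} [TopologicalSpace H] [TopologicalSpace V]
    (𝓗 : TopologicalGroupoid H V) (Z : Type u₅) [TopologicalSpace Z] where
  /-- moment map -/
  moment : Z → V
  /-- the action `z · η` -/
  smul : (z : Z) → (η : H) → moment z = 𝓗.r η → Z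
  moment_smul : ∀ z η h, moment (smul z η h) = 𝓗.s η
  smul_unit : ∀ z, smul z (𝓗.unit (moment z)) (𝓗.r_unit (moment z)).symm = z
  smul_mul : ∀ z η ζ (h₁ : moment z = 𝓗.r η) (h₂ : 𝓗.s η = 𝓗.r ζ),
    smul z (𝓗.mul η ζ h₂) (h₁.trans (𝓗.r_mul η ζ h₂).symm) =
      smul (smul z η h₁) ζ ((moment_smul z η h₁).trans h₂)
  continuous_moment : Continuous moment
  continuous_smul :
    Continuous fun p : {p : Z × H // moment p.1 = 𝓗.r p.2} => smul p.1.1 p.1.2 p.2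

namespace LeftAction

variable {G : Type u₁} {U : Type u₂} [TopologicalSpace G] [TopologicalSpace U]
  {𝓖 : TopologicalGroupoid G U} {Z : Type u₅} [TopologicalSpace Z]

/-- The action is free: only units fix points. -/
def IsFree (A : LeftAction 𝓖 Z) : Prop :=
  ∀ γ z h, A.smul γ z h = z → γ = 𝓖.unit (A.moment z)

/-- The action is proper: preimages of compact sets under `(γ, z) ↦ (γ · z, z)` are compact. -/
def IsProper (A : LeftAction 𝓖 Z) : Prop :=
  ∀ K : Set (Z × Z), IsCompact K →
    IsCompact ((fun p : {p : G × Z // 𝓖.s p.1 = A.moment p.2} =>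
      (A.smul p.1.1 p.1.2 p.2, p.1.2)) ⁻¹' K)

/-- Two points are equivalent when they lie in the same orbit. -/
def orbitSetoid (A : LeftAction 𝓖 Z) : Setoid Z where
  r z w := ∃ γ h, A.smul γ w h = z
  iseqv :=
    { refl := fun z => ⟨_, _, A.unit_smul z⟩
      symm := by
        rintro _ w ⟨γ, h, rfl⟩
        refine ⟨𝓖.inv γ, (𝓖.s_inv γ).trans (A.moment_smul γ w h).symm, ?_⟩
        rw [← A.mul_smul (𝓖.inv γ) γ w (𝓖.s_inv γ) h]
        have key : ∀ (η : G) (hη : 𝓖.s η = A.moment w), η = 𝓖.unit (A.moment w) →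
            A.smul η w hη = w := by
          rintro η hη rfl
          exact A.unit_smul w
        exact key _ _ (by rw [𝓖.inv_mul, h])
      trans := by
        rintro _ _ w ⟨γ, h, rfl⟩ ⟨η, h', rfl⟩
        exact ⟨_, _, A.mul_smul γ η w (h.trans (A.moment_smul η w h')) h'⟩ }

/-- The orbit space `G \ Z` with the quotient topology. -/
abbrev OrbitSpace (A : LeftAction 𝓖 Z) : Type u₅ := Quotient A.orbitSetoid

end LeftAction

namespace RightAction

variable {H : Type u₁} {V : Type u₂} [TopologicalSpace H] [TopologicalSpace V]
  {𝓗 : TopologicalGroupoid H V} {Z : Type u₅} [TopologicalSpace Z]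

/-- The action is free: only units fix points. -/
def IsFree (A : RightAction 𝓗 Z) : Prop :=
  ∀ z η h, A.smul z η h = z → η = 𝓗.unit (A.moment z)

/-- The action is proper: preimages of compact sets under `(z, η) ↦ (z · η, z)` are compact. -/
def IsProper (A : RightAction 𝓗 Z) : Prop :=
  ∀ K : Set (Z × Z), IsCompact K →
    IsCompact ((fun p : {p : Z × H // A.moment p.1 = 𝓗.r p.2} =>
      (A.smul p.1.1 p.1.2 p.2, p.1.1)) ⁻¹' K)

/-- Two points are equivalent when they lie in the same orbit. -/
def orbitSetoid (A : RightAction 𝓗 Z) : Setoid Z where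
  r z w := ∃ η h, A.smul w η h = z
  iseqv :=
    { refl := fun z => ⟨_, _, A.smul_unit z⟩
      symm := by
        rintro _ w ⟨η, h, rfl⟩
        refine ⟨𝓗.inv η, (A.moment_smul w η h).trans (𝓗.r_inv η).symm, ?_⟩
        rw [← A.smul_mul w η (𝓗.inv η) h (𝓗.r_inv η).symm]
        have key : ∀ (ζ : H) (hζ : A.moment w = 𝓗.r ζ), ζ = 𝓗.unit (A.moment w) →
            A.smul w ζ hζ = w := by
          rintro ζ hζ rfl
          exact A.smul_unit w
        exact key _ _ (by rw [𝓗.mul_inv, h])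
      trans := by
        rintro _ _ w ⟨γ, h, rfl⟩ ⟨η, h', rfl⟩
        exact ⟨_, _, A.smul_mul w η γ h' ((A.moment_smul w η h').symm.trans h)⟩ }

/-- The orbit space `Z / H` with the quotient topology. -/
abbrev OrbitSpace (A : RightAction 𝓗 Z) : Type u₅ := Quotient A.orbitSetoid

end RightAction

/-- The data and axioms that make a space `Z` a `(G, H)`-equivalence (that `Z` is locally compact
and Hausdorff is required in `TopologicalGroupoid.Equivalent`). -/
structure GroupoidEquivalence {G : Type u₁} {U : Type u₂} {H : Type u₃} {V : Type u₄}
    [TopologicalSpace G] [TopologicalSpace U] [TopologicalSpace H] [TopologicalSpace V]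
    (𝓖 : TopologicalGroupoid G U) (𝓗 : TopologicalGroupoid H V)
    (Z : Type u₅) [TopologicalSpace Z] where
  /-- the left `G`-action -/
  left : LeftAction 𝓖 Z
  /-- the right `H`-action -/
  right : RightAction 𝓗 Z
  left_free : left.IsFree
  left_proper : left.IsProper
  right_free : right.IsFree
  right_proper : right.IsProper
  /-- the actions commute (the first two parts make the third meaningful) -/
  right_moment_left_smul : ∀ γ z h, right.moment (left.smul γ z h) = right.moment z
  left_moment_right_smul : ∀ z η h, left.moment (right.smul z η h) = left.moment z
  smul_comm : ∀ γ z η (h₁ : 𝓖.s γ = left.moment z) (h₂ : right.moment z = 𝓗.r η),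
    right.smul (left.smul γ z h₁) η ((right_moment_left_smul γ z h₁).trans h₂) =
      left.smul γ (right.smul z η h₂) (h₁.trans (left_moment_right_smul z η h₂).symm)
  isOpenMap_left_moment : IsOpenMap left.moment
  /-- the left moment map induces a homeomorphism of `Z / H` onto the unit space of `G` -/
  left_moment_homeo : ∃ φ : right.OrbitSpace ≃ₜ U,
    ∀ z : Z, φ (Quotient.mk right.orbitSetoid z) = left.moment z
  isOpenMap_right_moment : IsOpenMap right.moment
  /-- the right moment map induces a homeomorphism of `G \ Z` onto the unit space of `H` -/
  right_moment_homeo : ∃ φ : left.OrbitSpace ≃ₜ V,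
    ∀ z : Z, φ (Quotient.mk left.orbitSetoid z) = right.moment z

/-- The Fell topology on the closed subsets of `X`: a subbasis is given by the sets of all `F`
missing a fixed compact set and of all `F` meeting a fixed open set. -/
@[reducible] def fellTopology (X : Type u₁) [TopologicalSpace X] : TopologicalSpace (Closeds X) :=
  generateFrom
    ({𝒰 | ∃ K : Set X, IsCompact K ∧ 𝒰 = {F : Closeds X | Disjoint (F : Set X) K}} ∪
      {𝒰 | ∃ O : Set X, IsOpen O ∧ 𝒰 = {F : Closeds X | ((F : Set X) ∩ O).Nonempty}})

namespace TopologicalGroupoid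

section

variable {G : Type u₁} {U : Type u₂} [TopologicalSpace G] [TopologicalSpace U]

/-- `G` and `H` are equivalent: there is a locally compact Hausdorff `(G, H)`-equivalence. -/
def Equivalent {H : Type u₃} {V : Type u₄} [TopologicalSpace H] [TopologicalSpace V]
    (𝓖 : TopologicalGroupoid G U) (𝓗 : TopologicalGroupoid H V) : Prop :=
  ∃ (Z : Type u₅) (_ : TopologicalSpace Z), T2Space Z ∧ LocallyCompactSpace Z ∧
    Nonempty (GroupoidEquivalence 𝓖 𝓗 Z)

/-- All isotropy groups `G(u) = {γ | r γ = u = s γ}` are abelian. -/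
def HasAbelianIsotropy (𝓖 : TopologicalGroupoid G U) : Prop :=
  ∀ γ η (h : 𝓖.s γ = 𝓖.r η) (h' : 𝓖.s η = 𝓖.r γ), 𝓖.r γ = 𝓖.s γ →
    𝓖.mul γ η h = 𝓖.mul η γ h'

/-- The canonical action of a groupoid on its unit space, `γ · s(γ) = r(γ)`. -/
def unitAction (𝓖 : TopologicalGroupoid G U) : LeftAction 𝓖 U where
  moment u := u
  smul γ _ _ := 𝓖.r γ
  moment_smul _ _ _ := rfl
  unit_smul := 𝓖.r_unit
  mul_smul γ η _ h₁ _ := 𝓖.r_mul γ η h₁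
  continuous_moment := continuous_id
  continuous_smul := 𝓖.continuous_r.comp (continuous_fst.comp continuous_subtype_val)

/-- The closed subgroups of `G`: closed subsets that are subgroups of an isotropy group `G(u)`;
`base` is the (uniquely determined) point `u`. -/
structure ClosedSubgroup (𝓖 : TopologicalGroupoid G U) where
  /-- the unit `u` with `carrier ⊆ G(u)` -/
  base : U
  /-- the underlying set -/
  carrier : Set G
  isClosed : IsClosed carrier
  r_eq : ∀ γ ∈ carrier, 𝓖.r γ = base
  s_eq : ∀ γ ∈ carrier, 𝓖.s γ = base
  unit_mem : 𝓖.unit base ∈ carrier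
  mul_mem : ∀ γ ∈ carrier, ∀ η ∈ carrier, ∀ h, 𝓖.mul γ η h ∈ carrier
  inv_mem : ∀ γ ∈ carrier, 𝓖.inv γ ∈ carrier

/-- A closed subgroup as a closed subset of `G`. -/
def ClosedSubgroup.toCloseds {𝓖 : TopologicalGroupoid G U} (S : 𝓖.ClosedSubgroup) : Closeds G :=
  ⟨S.carrier, S.isClosed⟩

/-- The space of closed subgroups has the relative Fell topology. -/
instance (𝓖 : TopologicalGroupoid G U) : TopologicalSpace 𝓖.ClosedSubgroup :=
  TopologicalSpace.induced ClosedSubgroup.toCloseds (fellTopology G)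

/-- The set `γ S γ⁻¹ = {γ ξ γ⁻¹ | ξ ∈ S}`. -/
def conj (𝓖 : TopologicalGroupoid G U) (γ : G) (S : Set G) : Set G :=
  {η | ∃ ξ ∈ S, ∃ (h₁ : 𝓖.s γ = 𝓖.r ξ) (h₂ : 𝓖.s (𝓖.mul γ ξ h₁) = 𝓖.r (𝓖.inv γ)),
    η = 𝓖.mul (𝓖.mul γ ξ h₁) (𝓖.inv γ) h₂}

/-- The map `π(γ) = (r(γ), s(γ))`. -/
def π (𝓖 : TopologicalGroupoid G U) (γ : G) : U × U := (𝓖.r γ, 𝓖.s γ)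

/-- The groupoid `R = π(G) ⊆ U × U` with the relative product topology and operations
`(u, v)(v, w) = (u, w)`, `(u, v)⁻¹ = (v, u)`. -/
def R (𝓖 : TopologicalGroupoid G U) : TopologicalGroupoid (Set.range 𝓖.π) U where
  r p := p.1.1
  s p := p.1.2
  unit u := ⟨(u, u), 𝓖.unit u, Prod.ext (𝓖.r_unit u) (𝓖.s_unit u)⟩
  inv p := ⟨(p.1.2, p.1.1), by
    obtain ⟨_, γ, rfl⟩ := p
    exact ⟨𝓖.inv γ, Prod.ext (𝓖.r_inv γ) (𝓖.s_inv γ)⟩⟩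
  mul p q h := ⟨(p.1.1, q.1.2), by
    obtain ⟨_, γ, rfl⟩ := p
    obtain ⟨_, η, rfl⟩ := q
    exact ⟨𝓖.mul γ η h, Prod.ext (𝓖.r_mul γ η h) (𝓖.s_mul γ η h)⟩⟩
  r_unit _ := rfl
  s_unit _ := rfl
  r_inv _ := rfl
  s_inv _ := rfl
  r_mul _ _ _ := rfl
  s_mul _ _ _ := rfl
  mul_assoc _ _ _ _ _ := rfl
  unit_mul _ := rfl
  mul_unit _ := rfl
  mul_inv _ := rfl
  inv_mul _ := rfl
  continuous_r := by fun_prop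
  continuous_s := by fun_prop
  continuous_unit := by fun_prop
  continuous_inv := by fun_prop
  continuous_mul := by fun_prop

/-- `R` acts continuously on the space of closed subgroups of `G` by `π(γ) · S = γ S γ⁻¹`
(with moment map sending a subgroup of `G(u)` to `u`). -/
def RActsContinuously (𝓖 : TopologicalGroupoid G U) : Prop :=
  ∃ A : LeftAction 𝓖.R 𝓖.ClosedSubgroup,
    (∀ S, A.moment S = S.base) ∧
    ∀ (γ : G) (S : 𝓖.ClosedSubgroup) (h : 𝓖.s γ = A.moment S),
      (A.smul ⟨𝓖.π γ, γ, rfl⟩ S h).carrier = 𝓖.conj γ S.carrier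

/-- `G` is proper modulo its isotropy: it has abelian isotropy, its orbit space is Hausdorff, and
`R` acts continuously on the space of closed subgroups. -/
def IsProperModuloIsotropy (𝓖 : TopologicalGroupoid G U) : Prop :=
  𝓖.HasAbelianIsotropy ∧ T2Space 𝓖.unitAction.OrbitSpace ∧ 𝓖.RActsContinuously

/-- The blow-up `G[X] = {(x, γ, y) | f x = r γ, s γ = f y}` of `G` along a continuous map
`f : X → U`, with unit space `X` and product `(x, γ, y)(y, η, z) = (x, γη, z)`. -/
def blowUp (𝓖 : TopologicalGroupoid G U) {X : Type u₅} [TopologicalSpace X] (f : X → U)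
    (hf : Continuous f) :
    TopologicalGroupoid {p : X × G × X // f p.1 = 𝓖.r p.2.1 ∧ 𝓖.s p.2.1 = f p.2.2} X where
  r p := p.1.1
  s p := p.1.2.2
  unit x := ⟨(x, 𝓖.unit (f x), x), (𝓖.r_unit (f x)).symm, 𝓖.s_unit (f x)⟩
  inv p := ⟨(p.1.2.2, 𝓖.inv p.1.2.1, p.1.1),
    p.2.2.symm.trans (𝓖.r_inv _).symm, (𝓖.s_inv _).trans p.2.1.symm⟩
  mul p q h := ⟨(p.1.1, 𝓖.mul p.1.2.1 q.1.2.1 (p.2.2.trans ((congrArg f h).trans q.2.1)), q.1.2.2),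
    p.2.1.trans (𝓖.r_mul _ _ _).symm, (𝓖.s_mul _ _ _).trans q.2.2⟩
  r_unit _ := rfl
  s_unit _ := rfl
  r_inv _ := rfl
  s_inv _ := rfl
  r_mul _ _ _ := rfl
  s_mul _ _ _ := rfl
  mul_assoc p q t h₁ h₂ := Subtype.ext <| Prod.ext rfl <| Prod.ext (𝓖.mul_assoc _ _ _ _ _) rfl
  unit_mul := by
    rintro ⟨⟨x, γ, y⟩, hx, hy⟩
    refine Subtype.ext (Prod.ext rfl (Prod.ext ?_ rfl))
    have key : ∀ (ε : G) (h : 𝓖.s ε = 𝓖.r γ), ε = 𝓖.unit (𝓖.r γ) → 𝓖.mul ε γ h = γ := by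
      rintro ε h rfl
      exact 𝓖.unit_mul γ
    exact key _ _ (congrArg 𝓖.unit hx)
  mul_unit := by
    rintro ⟨⟨x, γ, y⟩, hx, hy⟩
    refine Subtype.ext (Prod.ext rfl (Prod.ext ?_ rfl))
    have key : ∀ (ε : G) (h : 𝓖.s γ = 𝓖.r ε), ε = 𝓖.unit (𝓖.s γ) → 𝓖.mul γ ε h = γ := by
      rintro ε h rfl
      exact 𝓖.mul_unit γ
    exact key _ _ (congrArg 𝓖.unit hy.symm)
  mul_inv p := Subtype.ext <| Prod.ext rfl <| Prod.ext
    ((𝓖.mul_inv _).trans (congrArg 𝓖.unit p.2.1.symm)) rfl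
  inv_mul p := Subtype.ext <| Prod.ext rfl <| Prod.ext
    ((𝓖.inv_mul _).trans (congrArg 𝓖.unit p.2.2)) rfl
  continuous_r := by fun_prop
  continuous_s := by fun_prop
  continuous_unit := by
    have := 𝓖.continuous_unit
    fun_prop
  continuous_inv := by
    have := 𝓖.continuous_inv
    fun_prop
  continuous_mul := by
    refine Continuous.subtype_mk (Continuous.prodMk (by fun_prop)
      (Continuous.prodMk ?_ (by fun_prop))) _
    exact 𝓖.continuous_mul.comp
      (Continuous.subtype_mk (f := fun p : {p : {p : X × G × X // f p.1 = 𝓖.r p.2.1 ∧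
          𝓖.s p.2.1 = f p.2.2} × {p : X × G × X // f p.1 = 𝓖.r p.2.1 ∧ 𝓖.s p.2.1 = f p.2.2} //
          p.1.1.2.2 = p.2.1.1} => (p.1.1.1.2.1, p.1.2.1.2.1)) (by fun_prop)
        (fun p => p.1.1.2.2.trans ((congrArg f p.2).trans p.1.2.2.1)))

end

end TopologicalGroupoid

/-! All conditions involved are invariant under blowing up along an open surjection. If Z is a (G,
H)-equivalence, the relation γ·w = z·η is the graph of an isomorphism between the blow-ups of G and
H along the two moment maps; likewise G and G[X] are linked over X by f and the identity.
`BlowUpIso` abstracts both situations, and its symmetry under `swap` means that each property only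
has to be transferred in one direction.

For z in Z the isotropy groups at a z and b z are isomorphic, and two points of Z have a-images in
one orbit exactly when their b-images are. This transfers commutativity of the isotropy and the
Hausdorff property of the orbit space.

For the action, the isomorphism carries closed subgroups at a z to closed subgroups at b z,
continuously in z and the subgroup together (`continuous_push`). To act by (b z, b w) on a subgroup
S at b w, carry S to a w, act there by (a z, a w), and carry the result to b z. By
`pushSet_swap_conj` this yields ηSη⁻¹ for every η over (b z, b w), so the choice of z and w is
immaterial. The construction is continuous on the space of lifted data, and
`isQuotientMap_toActionDomain` lets it descend. -/

open Filter

/-! ### Groupoid algebra and conjugation. -/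

namespace TopologicalGroupoid

section

variable {G : Type u₁} {U : Type u₂} [TopologicalSpace G] [TopologicalSpace U]
  (𝓖 : TopologicalGroupoid G U)

open Classical in
/-- Multiplication extended to a total operation, with a default value on pairs that are not
composable. -/
noncomputable def m (γ η : G) : G := if h : 𝓖.s γ = 𝓖.r η then 𝓖.mul γ η h else γ

lemma m_eq {γ η : G} (h : 𝓖.s γ = 𝓖.r η) : 𝓖.m γ η = 𝓖.mul γ η h := dif_pos h

lemma r_m {γ η : G} (h : 𝓖.s γ = 𝓖.r η) : 𝓖.r (𝓖.m γ η) = 𝓖.r γ := by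
  rw [m_eq _ h, r_mul]

lemma s_m {γ η : G} (h : 𝓖.s γ = 𝓖.r η) : 𝓖.s (𝓖.m γ η) = 𝓖.s η := by
  rw [m_eq _ h, s_mul]

lemma m_assoc {γ η ζ : G} (h₁ : 𝓖.s γ = 𝓖.r η) (h₂ : 𝓖.s η = 𝓖.r ζ) :
    𝓖.m (𝓖.m γ η) ζ = 𝓖.m γ (𝓖.m η ζ) := by
  rw [m_eq _ h₁, m_eq _ h₂, m_eq _ ((𝓖.s_mul γ η h₁).trans h₂),
    m_eq _ (h₁.trans (𝓖.r_mul η ζ h₂).symm), 𝓖.mul_assoc]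

lemma unit_m {γ : G} {u : U} (h : 𝓖.r γ = u) : 𝓖.m (𝓖.unit u) γ = γ := by
  subst h
  rw [m_eq _ (𝓖.s_unit _), 𝓖.unit_mul]

lemma m_unit {γ : G} {u : U} (h : 𝓖.s γ = u) : 𝓖.m γ (𝓖.unit u) = γ := by
  subst h
  rw [m_eq _ (𝓖.r_unit _).symm, 𝓖.mul_unit]

lemma m_inv (γ : G) : 𝓖.m γ (𝓖.inv γ) = 𝓖.unit (𝓖.r γ) := by
  rw [m_eq _ (𝓖.r_inv γ).symm, 𝓖.mul_inv]

lemma inv_m (γ : G) : 𝓖.m (𝓖.inv γ) γ = 𝓖.unit (𝓖.s γ) := by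
  rw [m_eq _ (𝓖.s_inv γ), 𝓖.inv_mul]

lemma inv_m_cancel {γ η : G} (h : 𝓖.s γ = 𝓖.r η) : 𝓖.m (𝓖.inv γ) (𝓖.m γ η) = η := by
  rw [← 𝓖.m_assoc (𝓖.s_inv γ) h, inv_m, 𝓖.unit_m h.symm]

lemma eq_inv_of_m_eq_unit {γ η : G} {u : U} (h : 𝓖.s γ = 𝓖.r η)
    (e : 𝓖.m γ η = 𝓖.unit u) (hu : 𝓖.r γ = u) : η = 𝓖.inv γ := by
  rw [← 𝓖.inv_m_cancel h, e, 𝓖.m_unit ((𝓖.s_inv γ).trans hu)]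

lemma eq_unit_of_m_self {γ : G} {u : U} (hr : 𝓖.r γ = u) (hs : 𝓖.s γ = u)
    (e : 𝓖.m γ γ = γ) : γ = 𝓖.unit u := by
  have h := 𝓖.inv_m_cancel (hs.trans hr.symm)
  rw [e, inv_m, hs] at h
  exact h.symm

lemma inv_m_rev {γ η : G} (h : 𝓖.s γ = 𝓖.r η) :
    𝓖.inv (𝓖.m γ η) = 𝓖.m (𝓖.inv η) (𝓖.inv γ) := by
  have h' : 𝓖.s (𝓖.inv η) = 𝓖.r (𝓖.inv γ) := by rw [s_inv, r_inv, h]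
  symm
  refine 𝓖.eq_inv_of_m_eq_unit (u := 𝓖.r γ) ?_ ?_ (𝓖.r_m h)
  · rw [𝓖.r_m h', 𝓖.s_m h, r_inv]
  · rw [𝓖.m_assoc h (by rw [𝓖.r_m h', r_inv]), ← 𝓖.m_assoc (𝓖.r_inv η).symm h', m_inv,
      𝓖.unit_m (by rw [r_inv, h]), m_inv]

/-- Trades the composability proofs inside `conj` for the total product `m`, so that conjugates can
be rewritten freely. -/
lemma mem_conj {γ η : G} {S : Set G} :
    η ∈ 𝓖.conj γ S ↔ ∃ ξ ∈ S, 𝓖.s γ = 𝓖.r ξ ∧ 𝓖.s ξ = 𝓖.s γ ∧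
      η = 𝓖.m (𝓖.m γ ξ) (𝓖.inv γ) := by
  constructor
  · rintro ⟨ξ, hξ, h₁, h₂, rfl⟩
    refine ⟨ξ, hξ, h₁, ?_, ?_⟩
    · rwa [s_mul, r_inv] at h₂
    · rw [𝓖.m_eq h₁, 𝓖.m_eq h₂]
  · rintro ⟨ξ, hξ, h₁, h₂, rfl⟩
    have h₃ : 𝓖.s (𝓖.mul γ ξ h₁) = 𝓖.r (𝓖.inv γ) := by rw [s_mul, r_inv, h₂]
    exact ⟨ξ, hξ, h₁, h₃, by rw [𝓖.m_eq h₁, 𝓖.m_eq h₃]⟩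

lemma conj_unit (S : 𝓖.ClosedSubgroup) : 𝓖.conj (𝓖.unit S.base) S.carrier = S.carrier := by
  have key : ∀ ξ ∈ S.carrier,
      𝓖.m (𝓖.m (𝓖.unit S.base) ξ) (𝓖.inv (𝓖.unit S.base)) = ξ := by
    intro ξ hξ
    have hi : 𝓖.unit S.base = 𝓖.inv (𝓖.unit S.base) :=
      𝓖.eq_inv_of_m_eq_unit (by rw [s_unit, r_unit]) (𝓖.unit_m (𝓖.r_unit _)) (𝓖.r_unit _)
    rw [𝓖.unit_m (S.r_eq ξ hξ), ← hi, 𝓖.m_unit (S.s_eq ξ hξ)]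
  ext η
  rw [mem_conj]
  constructor
  · rintro ⟨ξ, hξ, -, -, rfl⟩
    rwa [key ξ hξ]
  · intro hη
    exact ⟨η, hη, by rw [s_unit, S.r_eq η hη], by rw [s_unit, S.s_eq η hη], (key η hη).symm⟩

/-- Together with `conj_unit`, this supplies the axioms of the transported action. -/
lemma conj_m {γ η : G} (h : 𝓖.s γ = 𝓖.r η) (S : Set G) :
    𝓖.conj (𝓖.m γ η) S = 𝓖.conj γ (𝓖.conj η S) := by
  have key : ∀ ξ, 𝓖.s η = 𝓖.r ξ → 𝓖.s ξ = 𝓖.s η →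
      𝓖.m (𝓖.m (𝓖.m γ η) ξ) (𝓖.inv (𝓖.m γ η)) =
        𝓖.m (𝓖.m γ (𝓖.m (𝓖.m η ξ) (𝓖.inv η))) (𝓖.inv γ) := by
    intro ξ h₁ h₂
    have h₃ : 𝓖.s (𝓖.m η ξ) = 𝓖.r (𝓖.inv η) := by rw [𝓖.s_m h₁, r_inv, h₂]
    have h₄ : 𝓖.s (𝓖.inv η) = 𝓖.r (𝓖.inv γ) := by rw [s_inv, r_inv, h]
    have h₅ : 𝓖.s γ = 𝓖.r (𝓖.m η ξ) := by rw [𝓖.r_m h₁, h]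
    rw [𝓖.inv_m_rev h, 𝓖.m_assoc h h₁, ← 𝓖.m_assoc h₅ h₃,
      𝓖.m_assoc (by rw [𝓖.s_m h₅, h₃]) h₄]
  ext ζ
  simp only [mem_conj]
  constructor
  · rintro ⟨ξ, hξ, h₁, h₂, rfl⟩
    rw [𝓖.s_m h] at h₁ h₂
    have h₃ : 𝓖.s (𝓖.m η ξ) = 𝓖.r (𝓖.inv η) := by rw [𝓖.s_m h₁, r_inv, h₂]
    refine ⟨_, ⟨ξ, hξ, h₁, h₂, rfl⟩, ?_, ?_, key ξ h₁ h₂⟩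
    · rw [𝓖.r_m h₃, 𝓖.r_m h₁, h]
    · rw [𝓖.s_m h₃, s_inv, h]
  · rintro ⟨_, ⟨ξ, hξ, h₁, h₂, rfl⟩, -, -, rfl⟩
    exact ⟨ξ, hξ, by rw [𝓖.s_m h, h₁], by rw [𝓖.s_m h, h₂], (key ξ h₁ h₂).symm⟩

/-! ### Hausdorff units and the Fell topology on closed subgroups. -/

lemma t2Space_units (𝓖 : TopologicalGroupoid G U) [T2Space G] : T2Space U :=
  T2Space.of_injective_continuous (Function.LeftInverse.injective 𝓖.r_unit) 𝓖.continuous_unit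

variable {𝓖}

/-- The base is determined by the carrier: it is the range of any element, and the carrier contains
a unit. -/
lemma ClosedSubgroup.ext_carrier {S T : 𝓖.ClosedSubgroup} (h : S.carrier = T.carrier) :
    S = T := by
  have hb : S.base = T.base := by
    rw [← 𝓖.r_unit S.base]
    exact T.r_eq _ (h ▸ S.unit_mem)
  cases S
  cases T
  simp only at h hb
  subst h hb
  rfl

lemma ClosedSubgroup.isOpen_disjoint {K : Set G} (hK : IsCompact K) :
    IsOpen {S : 𝓖.ClosedSubgroup | Disjoint S.carrier K} :=
  ⟨_, GenerateOpen.basic _ (Or.inl ⟨K, hK, rfl⟩), rfl⟩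

lemma ClosedSubgroup.isOpen_meets {O : Set G} (hO : IsOpen O) :
    IsOpen {S : 𝓖.ClosedSubgroup | (S.carrier ∩ O).Nonempty} :=
  ⟨_, GenerateOpen.basic _ (Or.inr ⟨O, hO, rfl⟩), rfl⟩

lemma ClosedSubgroup.continuous_of_isOpen {Y : Type*} [TopologicalSpace Y]
    {F : Y → 𝓖.ClosedSubgroup}
    (h₁ : ∀ K : Set G, IsCompact K → IsOpen {y | Disjoint (F y).carrier K})
    (h₂ : ∀ O : Set G, IsOpen O → IsOpen {y | ((F y).carrier ∩ O).Nonempty}) :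
    Continuous F := by
  let _ : TopologicalSpace (Closeds G) := fellTopology G
  refine continuous_induced_rng.2 (continuous_generateFrom_iff.2 ?_)
  rintro _ (⟨K, hK, rfl⟩ | ⟨O, hO, rfl⟩)
  · exact h₁ K hK
  · exact h₂ O hO

/-- All elements of a subgroup have the base as range and there is at least one, so the base lies in
W exactly when the subgroup meets the open set `r ⁻¹' W`. -/
lemma ClosedSubgroup.continuous_base :
    Continuous (ClosedSubgroup.base : 𝓖.ClosedSubgroup → U) := by
  refine continuous_def.2 fun W hW => ?_
  convert ClosedSubgroup.isOpen_meets (𝓖 := 𝓖) (hW.preimage 𝓖.continuous_r) using 1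
  ext S
  constructor
  · intro h
    exact ⟨_, S.unit_mem, by simpa [𝓖.r_unit] using h⟩
  · rintro ⟨γ, hγ, hW⟩
    simpa [S.r_eq γ hγ] using hW

end

/-! ### Isomorphisms of blow-ups. -/

/-- Two open surjections `a`, `b` from a space `Z` onto the unit spaces of two groupoids, with an
isomorphism over `Z` of the blow-ups along `a` and along `b`, given by its graph:
`link z w γ η` says that `(z, γ, w)` corresponds to `(z, η, w)`. -/
structure BlowUpIso {G : Type u₁} {U : Type u₂} {H : Type u₃} {V : Type u₄}
    [TopologicalSpace G] [TopologicalSpace U] [TopologicalSpace H] [TopologicalSpace V]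
    (𝓖 : TopologicalGroupoid G U) (𝓗 : TopologicalGroupoid H V)
    (Z : Type u₅) [TopologicalSpace Z] where
  /-- the map to the unit space of the first groupoid -/
  a : Z → U
  /-- the map to the unit space of the second groupoid -/
  b : Z → V
  continuous_a : Continuous a
  continuous_b : Continuous b
  isOpenMap_a : IsOpenMap a
  isOpenMap_b : IsOpenMap b
  surjective_a : Function.Surjective a
  surjective_b : Function.Surjective b
  /-- the graph of the isomorphism -/
  link : Z → Z → G → H → Prop
  r_left : ∀ {z w γ η}, link z w γ η → 𝓖.r γ = a z
  s_left : ∀ {z w γ η}, link z w γ η → 𝓖.s γ = a w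
  r_right : ∀ {z w γ η}, link z w γ η → 𝓗.r η = b z
  s_right : ∀ {z w γ η}, link z w γ η → 𝓗.s η = b w
  exists_right : ∀ {z w γ}, 𝓖.r γ = a z → 𝓖.s γ = a w → ∃ η, link z w γ η
  exists_left : ∀ {z w η}, 𝓗.r η = b z → 𝓗.s η = b w → ∃ γ, link z w γ η
  unique_right : ∀ {z w γ η η'}, link z w γ η → link z w γ η' → η = η'
  unique_left : ∀ {z w γ γ' η}, link z w γ η → link z w γ' η → γ = γ'
  link_m : ∀ {z w v γ η γ' η'}, link z w γ η → link w v γ' η' →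
    link z v (𝓖.m γ γ') (𝓗.m η η')
  -- Continuity of the isomorphism, read off its graph. Nearby triples outside the blow-up have no
  -- partner and satisfy the condition vacuously.
  eventually_right : ∀ {z w γ η}, link z w γ η → ∀ O ∈ 𝓝 η,
    ∀ᶠ p : Z × Z × G in 𝓝 (z, w, γ), ∀ η', link p.1 p.2.1 p.2.2 η' → η' ∈ O
  eventually_left : ∀ {z w γ η}, link z w γ η → ∀ O ∈ 𝓝 γ,
    ∀ᶠ p : Z × Z × H in 𝓝 (z, w, η), ∀ γ', link p.1 p.2.1 γ' p.2.2 → γ' ∈ O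

namespace BlowUpIso

variable {G : Type u₁} {U : Type u₂} {H : Type u₃} {V : Type u₄}
  [TopologicalSpace G] [TopologicalSpace U] [TopologicalSpace H] [TopologicalSpace V]
  {𝓖 : TopologicalGroupoid G U} {𝓗 : TopologicalGroupoid H V}
  {Z : Type u₅} [TopologicalSpace Z]

/-- The inverse isomorphism. -/
def swap (E : BlowUpIso 𝓖 𝓗 Z) : BlowUpIso 𝓗 𝓖 Z where
  a := E.b
  b := E.a
  continuous_a := E.continuous_b
  continuous_b := E.continuous_a
  isOpenMap_a := E.isOpenMap_b
  isOpenMap_b := E.isOpenMap_a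
  surjective_a := E.surjective_b
  surjective_b := E.surjective_a
  link z w η γ := E.link z w γ η
  r_left := E.r_right
  s_left := E.s_right
  r_right := E.r_left
  s_right := E.s_left
  exists_right := E.exists_left
  exists_left := E.exists_right
  unique_right := E.unique_left
  unique_left := E.unique_right
  link_m := E.link_m
  eventually_right := E.eventually_left
  eventually_left := E.eventually_right

variable (E : BlowUpIso 𝓖 𝓗 Z)

/-- Compatibility with products is enough: the partner of a unit is idempotent by uniqueness, and an
idempotent of an isotropy group is the identity. -/
lemma link_unit (z : Z) : E.link z z (𝓖.unit (E.a z)) (𝓗.unit (E.b z)) := by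
  obtain ⟨η, h⟩ := E.exists_right (z := z) (w := z) (𝓖.r_unit (E.a z)) (𝓖.s_unit (E.a z))
  have h' := E.link_m h h
  rw [𝓖.unit_m (𝓖.r_unit _)] at h'
  rwa [← 𝓗.eq_unit_of_m_self (E.r_right h) (E.s_right h) (E.unique_right h' h)]

lemma link_inv {z w : Z} {γ : G} {η : H} (h : E.link z w γ η) :
    E.link w z (𝓖.inv γ) (𝓗.inv η) := by
  obtain ⟨η', h'⟩ := E.exists_right (z := w) (w := z) (γ := 𝓖.inv γ)
    ((𝓖.r_inv γ).trans (E.s_left h)) ((𝓖.s_inv γ).trans (E.r_left h))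
  have h₁ := E.link_m h h'
  rw [𝓖.m_inv, E.r_left h] at h₁
  rwa [← 𝓗.eq_inv_of_m_eq_unit ((E.s_right h).trans (E.r_right h').symm)
    (E.unique_right h₁ (E.link_unit z)) (E.r_right h)]

/-! ### Transport of closed subgroups. -/

/-- The subset of the isotropy of `𝓗` at `b z` that corresponds to a subset of the isotropy of `𝓖`
at `a z`. -/
def pushSet (z : Z) (S : Set G) : Set H := {η | ∃ γ ∈ S, E.link z z γ η}

/-- The pullback of `Z` and the space of closed subgroups. -/
abbrev Pairs : Type _ := {p : Z × 𝓖.ClosedSubgroup // p.2.base = E.a p.1}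

/-- This closedness yields both that transported subgroups are closed and the compact-set half of
`continuous_push`. If η is not in the isotropy at b z, that persists nearby because the units are
Hausdorff. Otherwise η is linked to some γ outside S; take a compact neighbourhood K of γ missing S.
Nearby subgroups still miss K, while every partner of a nearby element lies in K. -/
lemma eventually_notMem_pushSet [LocallyCompactSpace G] [T2Space H] {η : H} {y : E.Pairs}
    (h : η ∉ E.pushSet y.1.1 y.1.2.carrier) :
    ∀ᶠ q : H × E.Pairs in 𝓝 (η, y), q.1 ∉ E.pushSet q.2.1.1 q.2.1.2.carrier := by
  have := 𝓗.t2Space_units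
  have hb := E.continuous_b
  have hr := 𝓗.continuous_r
  have hs := 𝓗.continuous_s
  by_cases hη : 𝓗.r η = E.b y.1.1 ∧ 𝓗.s η = E.b y.1.1
  · obtain ⟨γ, hγ⟩ := E.exists_left hη.1 hη.2
    have hγS : γ ∈ (y.1.2.carrier)ᶜ := fun h' => h ⟨γ, h', hγ⟩
    obtain ⟨K, hK, hKS, hKc⟩ := local_compact_nhds (y.1.2.isClosed.isOpen_compl.mem_nhds hγS)
    have t : Tendsto (fun q : H × E.Pairs => (q.2.1.1, q.2.1.1, q.1)) (𝓝 (η, y))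
        (𝓝 (y.1.1, y.1.1, η)) := by
      have : Continuous (fun q : H × E.Pairs => (q.2.1.1, q.2.1.1, q.1)) := by fun_prop
      exact this.tendsto (η, y)
    have t' : Tendsto (fun q : H × E.Pairs => q.2.1.2) (𝓝 (η, y)) (𝓝 y.1.2) := by
      have : Continuous (fun q : H × E.Pairs => q.2.1.2) := by fun_prop
      exact this.tendsto (η, y)
    have e₂ : ∀ᶠ S in 𝓝 y.1.2, Disjoint S.carrier K :=
      (ClosedSubgroup.isOpen_disjoint hKc).mem_nhds (disjoint_compl_right.mono_right hKS)
    filter_upwards [t.eventually (E.eventually_left hγ K hK), t'.eventually e₂] with q h₁ h₂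
    rintro ⟨γ', hγ', hl⟩
    exact Set.disjoint_left.1 h₂ hγ' (h₁ γ' hl)
  · have hc : IsClosed {q : H × E.Pairs | 𝓗.r q.1 = E.b q.2.1.1 ∧ 𝓗.s q.1 = E.b q.2.1.1} :=
      (isClosed_eq (by fun_prop) (by fun_prop)).inter (isClosed_eq (by fun_prop) (by fun_prop))
    filter_upwards [hc.isOpen_compl.mem_nhds hη] with q hq
    rintro ⟨γ', -, hl⟩
    exact hq ⟨E.r_right hl, E.s_right hl⟩

/-- The closed subgroup of `𝓗` at `b z` that corresponds to a closed subgroup of `𝓖` at `a z`. -/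
def push [LocallyCompactSpace G] [T2Space H] (y : E.Pairs) : 𝓗.ClosedSubgroup where
  base := E.b y.1.1
  carrier := E.pushSet y.1.1 y.1.2.carrier
  isClosed := by
    refine isOpen_compl_iff.1 (isOpen_iff_mem_nhds.2 fun η hη => ?_)
    have t : Tendsto (fun η' : H => (η', y)) (𝓝 η) (𝓝 (η, y)) :=
      (Continuous.prodMk_left y).tendsto η
    exact t.eventually (E.eventually_notMem_pushSet hη)
  r_eq := fun _ ⟨_, _, h⟩ => E.r_right h
  s_eq := fun _ ⟨_, _, h⟩ => E.s_right h
  unit_mem := ⟨_, y.1.2.unit_mem, by rw [y.2]; exact E.link_unit _⟩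
  mul_mem := by
    rintro η ⟨γ, hγ, h⟩ η' ⟨γ', hγ', h'⟩ hη
    have hc : 𝓖.s γ = 𝓖.r γ' := (E.s_left h).trans (E.r_left h').symm
    refine ⟨𝓖.m γ γ', ?_, ?_⟩
    · rw [𝓖.m_eq hc]
      exact y.1.2.mul_mem _ hγ _ hγ' hc
    · rw [← 𝓗.m_eq hη]
      exact E.link_m h h'
  inv_mem := fun _ ⟨_, hγ, h⟩ => ⟨_, y.1.2.inv_mem _ hγ, E.link_inv h⟩

/-- The two kinds of subbasic sets use the two directions of the isomorphism: missing a compact set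
uses continuity from H to G, meeting an open set uses continuity from G to H. -/
lemma continuous_push [LocallyCompactSpace G] [T2Space H] : Continuous E.push := by
  refine ClosedSubgroup.continuous_of_isOpen (fun K hK => ?_) fun O hO => ?_
  · refine isOpen_iff_mem_nhds.2 fun y hy => ?_
    have h : ∀ᶠ y' in 𝓝 y, ∀ η ∈ K, η ∉ E.pushSet y'.1.1 y'.1.2.carrier := by
      -- Compactness of K turns the neighbourhoods found at each η into one neighbourhood of y.
      refine hK.eventually_forall_of_forall_eventually fun η hη => ?_
      have t : Tendsto (Prod.swap : E.Pairs × H → H × E.Pairs) (𝓝 (y, η)) (𝓝 (η, y)) :=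
        continuous_swap.tendsto _
      exact t.eventually (E.eventually_notMem_pushSet (Set.disjoint_right.1 hy hη))
    filter_upwards [h] with y' h'
    exact Set.disjoint_right.2 fun η hη => h' η hη
  · refine isOpen_iff_mem_nhds.2 ?_
    rintro y ⟨η, ⟨γ, hγ, hl⟩, hηO⟩
    have h := E.eventually_right hl O (hO.mem_nhds hηO)
    rw [nhds_prod_eq, nhds_prod_eq] at h
    obtain ⟨A, hA, B, hB, hAB⟩ := mem_prod_iff.1 h
    obtain ⟨C, hC, D, hD, hCD⟩ := mem_prod_iff.1 hB
    obtain ⟨D', hD', hDo, hγD⟩ := mem_nhds_iff.1 hD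
    have t : Tendsto (fun y' : E.Pairs => y'.1.1) (𝓝 y) (𝓝 y.1.1) := by
      have : Continuous (fun y' : E.Pairs => y'.1.1) := by fun_prop
      exact this.tendsto y
    have t' : Tendsto (fun y' : E.Pairs => y'.1.2) (𝓝 y) (𝓝 y.1.2) := by
      have : Continuous (fun y' : E.Pairs => y'.1.2) := by fun_prop
      exact this.tendsto y
    have e₂ : ∀ᶠ S in 𝓝 y.1.2, (S.carrier ∩ D').Nonempty :=
      (ClosedSubgroup.isOpen_meets hDo).mem_nhds ⟨γ, hγ, hγD⟩
    filter_upwards [t hA, t hC, t'.eventually e₂] with y' h₁ h₂ ⟨γ', hγ', hγD'⟩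
    obtain ⟨η', hl'⟩ := E.exists_right (z := y'.1.1) (w := y'.1.1) (γ := γ')
      ((y'.1.2.r_eq _ hγ').trans y'.2) ((y'.1.2.s_eq _ hγ').trans y'.2)
    exact ⟨η', ⟨γ', hγ', hl'⟩, hAB (mk_mem_prod h₁ (hCD (mk_mem_prod h₂ (hD' hγD')))) η' hl'⟩

/-- Links respect products and inverses, so conjugation by γ corresponds to conjugation by η. This
identifies the transported action with conjugation in H. -/
lemma pushSet_swap_conj {z w : Z} {γ : G} {η : H} (h : E.link z w γ η) (T : Set H) :
    E.pushSet z (𝓖.conj γ (E.swap.pushSet w T)) = 𝓗.conj η T := by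
  have key : ∀ {ξ ζ}, E.link w w ξ ζ →
      E.link z z (𝓖.m (𝓖.m γ ξ) (𝓖.inv γ)) (𝓗.m (𝓗.m η ζ) (𝓗.inv η)) :=
    fun h' => E.link_m (E.link_m h h') (E.link_inv h)
  ext θ
  constructor
  · rintro ⟨_, hc, hl⟩
    obtain ⟨ξ, ⟨ζ, hζ, h'⟩, -, -, rfl⟩ := 𝓖.mem_conj.1 hc
    change E.link w w ξ ζ at h'
    refine 𝓗.mem_conj.2 ⟨ζ, hζ, ?_, ?_, E.unique_right hl (key h')⟩
    · rw [E.s_right h, E.r_right h']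
    · rw [E.s_right h, E.s_right h']
  · intro hθ
    obtain ⟨ζ, hζ, h₁, h₂, rfl⟩ := 𝓗.mem_conj.1 hθ
    obtain ⟨ξ, h'⟩ := E.exists_left (z := w) (w := w) (η := ζ)
      (h₁.symm.trans (E.s_right h)) (h₂.trans (E.s_right h))
    refine ⟨_, 𝓖.mem_conj.2 ⟨ξ, ⟨ζ, hζ, h'⟩, ?_, ?_, rfl⟩, key h'⟩
    · rw [E.s_left h, E.r_left h']
    · rw [E.s_left h, E.s_left h']

end BlowUpIso
end TopologicalGroupoid

/-! ### Transfer of the three conditions along an isomorphism of blow-ups. -/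

namespace TopologicalGroupoid
namespace BlowUpIso

variable {G : Type u₁} {U : Type u₂} {H : Type u₃} {V : Type u₄}
  [TopologicalSpace G] [TopologicalSpace U] [TopologicalSpace H] [TopologicalSpace V]
  {𝓖 : TopologicalGroupoid G U} {𝓗 : TopologicalGroupoid H V}
  {Z : Type u₅} [TopologicalSpace Z]

/-- Over a point z mapping to the given unit, `link z z` is an isomorphism of isotropy groups. -/
lemma hasAbelianIsotropy (E : BlowUpIso 𝓖 𝓗 Z) (h : 𝓖.HasAbelianIsotropy) : 𝓗.HasAbelianIsotropy := by
  intro η η' h₁ h₂ h₃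
  obtain ⟨z, hz⟩ := E.surjective_b (𝓗.r η)
  obtain ⟨γ, hγ⟩ := E.exists_left (z := z) (w := z) hz.symm (h₃.symm.trans hz.symm)
  obtain ⟨γ', hγ'⟩ := E.exists_left (z := z) (w := z) (η := η')
    (h₁.symm.trans (h₃.symm.trans hz.symm)) (h₂.trans hz.symm)
  have e₁ : 𝓖.s γ = 𝓖.r γ' := (E.s_left hγ).trans (E.r_left hγ').symm
  have e₂ : 𝓖.s γ' = 𝓖.r γ := (E.s_left hγ').trans (E.r_left hγ).symm
  have hc := h γ γ' e₁ e₂ ((E.r_left hγ).trans (E.s_left hγ).symm)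
  rw [← 𝓖.m_eq e₁, ← 𝓖.m_eq e₂] at hc
  rw [← 𝓗.m_eq h₁, ← 𝓗.m_eq h₂]
  refine E.unique_right (E.link_m hγ hγ') ?_
  rw [hc]
  exact E.link_m hγ' hγ

lemma mem_range_π_iff (E : BlowUpIso 𝓖 𝓗 Z) (z w : Z) :
    (E.a z, E.a w) ∈ Set.range 𝓖.π ↔ (E.b z, E.b w) ∈ Set.range 𝓗.π := by
  constructor
  · rintro ⟨γ, hγ⟩
    obtain ⟨η, h⟩ := E.exists_right (z := z) (w := w)
      (congrArg Prod.fst hγ) (congrArg Prod.snd hγ)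
    exact ⟨η, Prod.ext (E.r_right h) (E.s_right h)⟩
  · rintro ⟨η, hη⟩
    obtain ⟨γ, h⟩ := E.exists_left (z := z) (w := w)
      (congrArg Prod.fst hη) (congrArg Prod.snd hη)
    exact ⟨γ, Prod.ext (E.r_left h) (E.s_left h)⟩

lemma mk_unitAction_eq_iff (𝓖 : TopologicalGroupoid G U) (u v : U) :
    Quotient.mk 𝓖.unitAction.orbitSetoid u = Quotient.mk 𝓖.unitAction.orbitSetoid v ↔
      (u, v) ∈ Set.range 𝓖.π := by
  rw [Quotient.eq]
  constructor
  · rintro ⟨γ, h, h'⟩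
    exact ⟨γ, Prod.ext h' h⟩
  · rintro ⟨γ, hγ⟩
    exact ⟨γ, congrArg Prod.snd hγ, congrArg Prod.fst hγ⟩

/-- Both orbit spaces are quotient sets of Z by the same relation, which gives a continuous
injection from one to the other; that already suffices for the Hausdorff property. -/
lemma t2Space_orbitSpace (E : BlowUpIso 𝓖 𝓗 Z) (h : T2Space 𝓖.unitAction.OrbitSpace) :
    T2Space 𝓗.unitAction.OrbitSpace := by
  have key : ∀ z w : Z, Quotient.mk 𝓖.unitAction.orbitSetoid (E.a z) =
      Quotient.mk 𝓖.unitAction.orbitSetoid (E.a w) ↔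
      Quotient.mk 𝓗.unitAction.orbitSetoid (E.b z) =
      Quotient.mk 𝓗.unitAction.orbitSetoid (E.b w) := by
    intro z w
    rw [mk_unitAction_eq_iff, mk_unitAction_eq_iff, E.mem_range_π_iff]
  let qa : Z → 𝓖.unitAction.OrbitSpace := fun z => Quotient.mk _ (E.a z)
  let qb : Z → 𝓗.unitAction.OrbitSpace := fun z => Quotient.mk _ (E.b z)
  have hqa : Continuous qa := continuous_quotient_mk'.comp E.continuous_a
  have hqb : IsQuotientMap qb := isQuotientMap_quotient_mk'.comp
    (E.isOpenMap_b.isQuotientMap E.continuous_b E.surjective_b)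
  -- The section need not be continuous: `key` makes g independent of it, and continuity comes from
  -- the quotient map `qb`.
  let g : 𝓗.unitAction.OrbitSpace → 𝓖.unitAction.OrbitSpace :=
    fun x => qa (Function.surjInv hqb.surjective x)
  have hg : ∀ z, g (qb z) = qa z := fun z =>
    (key _ _).2 (Function.surjInv_eq hqb.surjective (qb z))
  have hgc : Continuous g := hqb.continuous_iff.2 (by
    have : g ∘ qb = qa := funext hg
    rwa [this])
  refine T2Space.of_injective_continuous (f := g) ?_ hgc
  intro x y hxy
  obtain ⟨z, rfl⟩ := hqb.surjective x
  obtain ⟨w, rfl⟩ := hqb.surjective y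
  rw [hg, hg] at hxy
  exact (key z w).1 hxy

/-- Pairs of points of `Z` whose images are related by `𝓗`, with a closed subgroup of `𝓗` at the
second one. -/
abbrev Triples (E : BlowUpIso 𝓖 𝓗 Z) : Type _ :=
  {p : Z × Z × 𝓗.ClosedSubgroup //
    (E.b p.1, E.b p.2.1) ∈ Set.range 𝓗.π ∧ E.b p.2.1 = p.2.2.base}

/-- The domain of the action of `𝓗.R` on the closed subgroups of `𝓗`. -/
abbrev ActionDomain (𝓗 : TopologicalGroupoid H V) : Type _ :=
  {p : Set.range 𝓗.π × 𝓗.ClosedSubgroup // 𝓗.R.s p.1 = p.2.base}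

/-- The projection of triples onto the domain of the action. -/
def toActionDomain (E : BlowUpIso 𝓖 𝓗 Z) (t : E.Triples) : ActionDomain 𝓗 :=
  ⟨(⟨(E.b t.1.1, E.b t.1.2.1), t.2.1⟩, t.1.2.2), t.2.2⟩

/-- The triples are the full preimage of the action domain under the open map b × b × id, and an
open map stays open when restricted to a full preimage. -/
lemma isQuotientMap_toActionDomain (E : BlowUpIso 𝓖 𝓗 Z) :
    IsQuotientMap E.toActionDomain := by
  have hb := E.continuous_b
  have lift : ∀ (d : ActionDomain 𝓗) (z w : Z), E.b z = d.1.1.1.1 → E.b w = d.1.1.1.2 →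
      ∃ t : E.Triples, t.1 = (z, w, d.1.2) ∧ E.toActionDomain t = d := by
    rintro ⟨⟨⟨⟨v, v'⟩, hv⟩, S⟩, hS⟩ z w rfl rfl
    exact ⟨⟨(z, w, S), hv, hS⟩, rfl, rfl⟩
  refine IsOpenMap.isQuotientMap ?_ ?_ ?_
  · intro W hW
    obtain ⟨O, hO, rfl⟩ := isOpen_induced_iff.1 hW
    have ho : IsOpen ((Prod.map E.b (Prod.map E.b id)) '' O) :=
      (E.isOpenMap_b.prodMap (E.isOpenMap_b.prodMap IsOpenMap.id)) O hO
    let ι : ActionDomain 𝓗 → V × V × 𝓗.ClosedSubgroup :=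
      fun d => (d.1.1.1.1, d.1.1.1.2, d.1.2)
    have hι : Continuous ι := by fun_prop
    convert ho.preimage hι using 1
    ext d
    constructor
    · rintro ⟨t, ht, rfl⟩
      exact ⟨t.1, ht, rfl⟩
    · rintro ⟨⟨z, w, S⟩, hO, h⟩
      obtain ⟨t, ht, rfl⟩ := lift d z w (congrArg Prod.fst h)
        (congrArg (fun p => p.2.1) h)
      refine ⟨t, ?_, rfl⟩
      have hS : S = t.1.2.2 := congrArg (fun p => p.2.2) h
      subst hS
      change t.1 ∈ O
      rw [ht]
      exact hO
  · unfold toActionDomain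
    fun_prop
  · intro d
    obtain ⟨z, hz⟩ := E.surjective_b d.1.1.1.1
    obtain ⟨w, hw⟩ := E.surjective_b d.1.1.1.2
    obtain ⟨t, -, ht⟩ := lift d z w hz hw
    exact ⟨t, ht⟩

theorem rActsContinuously (E : BlowUpIso 𝓖 𝓗 Z) [LocallyCompactSpace G]
    [T2Space G] [LocallyCompactSpace H] [T2Space H]
    (h : 𝓖.RActsContinuously) : 𝓗.RActsContinuously := by
  obtain ⟨A, hA, hconj⟩ := h
  let pull : E.Triples → 𝓖.ClosedSubgroup :=
    fun t => E.swap.push ⟨(t.1.2.1, t.1.2.2), t.2.2.symm⟩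
  have hpull : Continuous pull := E.swap.continuous_push.comp (by fun_prop)
  have ha := E.continuous_a
  let act : E.Triples → 𝓖.ClosedSubgroup := fun t =>
    A.smul ⟨(E.a t.1.1, E.a t.1.2.1), (E.mem_range_π_iff _ _).2 t.2.1⟩ (pull t) (hA (pull t)).symm
  have hact : Continuous act := A.continuous_smul.comp
    (Continuous.subtype_mk (f := fun t : E.Triples =>
      ((⟨(E.a t.1.1, E.a t.1.2.1), (E.mem_range_π_iff _ _).2 t.2.1⟩ : Set.range 𝓖.π), pull t))
      (by fun_prop) fun t => (hA (pull t)).symm)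
  have hbase : ∀ t, (act t).base = E.a t.1.1 := fun t =>
    (hA _).symm.trans (A.moment_smul _ _ _)
  let F : E.Triples → 𝓗.ClosedSubgroup := fun t => E.push ⟨(t.1.1, act t), hbase t⟩
  have hF : Continuous F := E.continuous_push.comp (by fun_prop)
  -- The right side mentions only η and the subgroup, so F is constant on the fibres of
  -- `toActionDomain`.
  have hFc : ∀ t (η : H), 𝓗.π η = (E.b t.1.1, E.b t.1.2.1) →
      (F t).carrier = 𝓗.conj η t.1.2.2.carrier := by
    intro t η hη
    obtain ⟨γ, hl⟩ := E.exists_left (z := t.1.1) (w := t.1.2.1)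
      (congrArg Prod.fst hη) (congrArg Prod.snd hη)
    -- The partner γ of η lies over (a z, a w), so the action in G is conjugation by γ.
    have hp : (⟨(E.a t.1.1, E.a t.1.2.1), (E.mem_range_π_iff _ _).2 t.2.1⟩ : Set.range 𝓖.π) =
        ⟨𝓖.π γ, γ, rfl⟩ := Subtype.ext (Prod.ext (E.r_left hl).symm (E.s_left hl).symm)
    have hc : (act t).carrier = 𝓖.conj γ (pull t).carrier := by
      rw [← hconj γ (pull t) ((E.s_left hl).trans (hA (pull t)).symm)]
      simp only [act, hp]
    change E.pushSet t.1.1 (act t).carrier = _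
    rw [hc]
    exact E.pushSet_swap_conj hl _
  have hq := E.isQuotientMap_toActionDomain
  -- Defined through an arbitrary section; `hcq` shows that it is F descended, hence continuous.
  let c : ActionDomain 𝓗 → 𝓗.ClosedSubgroup := fun d => F (Function.surjInv hq.surjective d)
  have hcc : ∀ (d : ActionDomain 𝓗) (η : H), 𝓗.π η = d.1.1.1 →
      (c d).carrier = 𝓗.conj η d.1.2.carrier := by
    intro d η hη
    have e := Function.surjInv_eq hq.surjective d
    have e₁ : 𝓗.π η = (E.toActionDomain (Function.surjInv hq.surjective d)).1.1.1 := by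
      rw [e, hη]
    have e₂ : d.1.2 = (E.toActionDomain (Function.surjInv hq.surjective d)).1.2 := by rw [e]
    rw [e₂]
    exact hFc _ η e₁
  have hcq : c ∘ E.toActionDomain = F := by
    funext t
    obtain ⟨η, hη⟩ := t.2.1
    apply ClosedSubgroup.ext_carrier
    rw [hFc t η hη]
    exact hcc _ η hη
  have hcont : Continuous c := hq.continuous_iff.2 (by rwa [hcq])
  have hcbase : ∀ d, (c d).base = d.1.1.1.1 := by
    intro d
    have e := Function.surjInv_eq hq.surjective d
    change (E.toActionDomain (Function.surjInv hq.surjective d)).1.1.1.1 = _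
    rw [e]
  refine ⟨{ moment := ClosedSubgroup.base
            smul := fun p S h => c ⟨(p, S), h⟩
            moment_smul := fun p S h => hcbase _
            unit_smul := ?_
            mul_smul := ?_
            continuous_moment := ClosedSubgroup.continuous_base
            continuous_smul := hcont }, fun _ => rfl, ?_⟩
  · intro S
    apply ClosedSubgroup.ext_carrier
    refine (hcc ⟨(_, S), _⟩ (𝓗.unit S.base) ?_).trans (𝓗.conj_unit S)
    exact Prod.ext (𝓗.r_unit S.base) (𝓗.s_unit S.base)
  · rintro ⟨_, η, rfl⟩ ⟨_, η', rfl⟩ S h₁ h₂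
    have h₁' : 𝓗.s η = 𝓗.r η' := h₁
    apply ClosedSubgroup.ext_carrier
    refine (hcc ⟨(_, S), _⟩ (𝓗.m η η') ?_).trans ?_
    · exact Prod.ext (𝓗.r_m h₁') (𝓗.s_m h₁')
    · rw [𝓗.conj_m h₁', hcc _ η rfl, hcc _ η' rfl]
  · intro η S h
    exact hcc _ η rfl

theorem isProperModuloIsotropy (E : BlowUpIso 𝓖 𝓗 Z) [LocallyCompactSpace G]
    [T2Space G] [LocallyCompactSpace H] [T2Space H] (h : 𝓖.IsProperModuloIsotropy) : 𝓗.IsProperModuloIsotropy :=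
  ⟨E.hasAbelianIsotropy h.1, E.t2Space_orbitSpace h.2.1, E.rActsContinuously h.2.2⟩

end BlowUpIso

/-! ### The blow-up along an open surjection. -/

section

variable {G : Type u₁} {U : Type u₂} [TopologicalSpace G] [TopologicalSpace U]

/-- The blow-up along an open surjection `f` is isomorphic over `X` to its own blow-up along the
identity. -/
def blowUpIsoBlowUp (𝓖 : TopologicalGroupoid G U) {X : Type u₆} [TopologicalSpace X] {f : X → U}
    (hf : Continuous f) (ho : IsOpenMap f) (hs : Function.Surjective f) :
    BlowUpIso 𝓖 (𝓖.blowUp f hf) X where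
  a := f
  b := id
  continuous_a := hf
  continuous_b := continuous_id
  isOpenMap_a := ho
  isOpenMap_b := IsOpenMap.id
  surjective_a := hs
  surjective_b := Function.surjective_id
  link x y γ q := q.1 = (x, γ, y)
  r_left := by
    rintro x y γ ⟨_, hq, _⟩ rfl
    exact hq.symm
  s_left := by
    rintro x y γ ⟨_, _, hq⟩ rfl
    exact hq
  r_right := fun h => congrArg Prod.fst h
  s_right := fun h => congrArg (fun p => p.2.2) h
  exists_right := fun h h' => ⟨⟨_, h.symm, h'⟩, rfl⟩
  exists_left := by
    rintro x y ⟨⟨_, γ, _⟩, hq⟩ rfl rfl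
    exact ⟨γ, rfl⟩
  unique_right := fun h h' => Subtype.ext (h.trans h'.symm)
  unique_left := fun h h' => congrArg (fun p => p.2.1) (h.symm.trans h')
  link_m := by
    rintro x y z γ ⟨_, hq⟩ γ' ⟨_, hq'⟩ rfl rfl
    rw [(𝓖.blowUp f hf).m_eq rfl, 𝓖.m_eq (hq.2.trans hq'.1)]
    rfl
  eventually_right := by
    intro x y γ q hq O hO
    obtain ⟨W, hW, hWO⟩ := mem_nhds_subtype _ _ _ |>.1 hO
    have hc : Continuous fun p : X × X × G => (p.1, p.2.2, p.2.1) := by fun_prop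
    rw [hq] at hW
    filter_upwards [hc.continuousAt.preimage_mem_nhds (x := (x, y, γ)) hW] with p hp q' hq'
    exact hWO (by rw [mem_preimage, hq']; exact hp)
  eventually_left := by
    intro x y γ q hq O hO
    have hγ : q.1.2.1 = γ := congrArg (fun p => p.2.1) hq
    have hc : Continuous fun p : X × X × {p : X × G × X // f p.1 = 𝓖.r p.2.1 ∧
      𝓖.s p.2.1 = f p.2.2} => p.2.2.1.2.1 := by fun_prop
    rw [← hγ] at hO
    filter_upwards [hc.continuousAt.preimage_mem_nhds (x := (x, y, q)) hO] with p hp γ' hq'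
    have hγ' : p.2.2.1.2.1 = γ' := congrArg (fun p => p.2.1) hq'
    rw [← hγ']
    exact hp

/-- The units are Hausdorff, so the matching conditions cut out a closed subset of X × G × X. -/
lemma locallyCompactSpace_blowUp (𝓖 : TopologicalGroupoid G U) {X : Type u₆} [TopologicalSpace X]
    {f : X → U} (hf : Continuous f) [T2Space G] [LocallyCompactSpace G] [LocallyCompactSpace X] :
    LocallyCompactSpace {p : X × G × X // f p.1 = 𝓖.r p.2.1 ∧ 𝓖.s p.2.1 = f p.2.2} := by
  have := 𝓖.t2Space_units
  have hr := 𝓖.continuous_r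
  have hs := 𝓖.continuous_s
  have hc : IsClosed {p : X × G × X | f p.1 = 𝓖.r p.2.1 ∧ 𝓖.s p.2.1 = f p.2.2} :=
    (isClosed_eq (by fun_prop) (by fun_prop)).inter (isClosed_eq (by fun_prop) (by fun_prop))
  exact hc.isClosedEmbedding_subtypeVal.locallyCompactSpace

end

end TopologicalGroupoid

/-! ### Free and proper actions, on the left and on the right. -/

namespace LeftAction

variable {G : Type u₁} {U : Type u₂} [TopologicalSpace G] [TopologicalSpace U]
  {𝓖 : TopologicalGroupoid G U} {Z : Type u₅} [TopologicalSpace Z] (A : LeftAction 𝓖 Z)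

open Classical in
/-- The action extended to a total operation. -/
noncomputable def act (γ : G) (z : Z) : Z := if h : 𝓖.s γ = A.moment z then A.smul γ z h else z

variable {A}

lemma act_eq {γ : G} {z : Z} (h : 𝓖.s γ = A.moment z) : A.act γ z = A.smul γ z h := dif_pos h

lemma moment_act {γ : G} {z : Z} (h : 𝓖.s γ = A.moment z) : A.moment (A.act γ z) = 𝓖.r γ := by
  rw [act_eq h, A.moment_smul]

lemma unit_act (z : Z) : A.act (𝓖.unit (A.moment z)) z = z := by
  rw [act_eq (𝓖.s_unit _), A.unit_smul]

lemma m_act {γ η : G} {z : Z} (h₁ : 𝓖.s γ = 𝓖.r η) (h₂ : 𝓖.s η = A.moment z) :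
    A.act (𝓖.m γ η) z = A.act γ (A.act η z) := by
  rw [𝓖.m_eq h₁, act_eq h₂, act_eq ((𝓖.s_mul γ η h₁).trans h₂),
    act_eq (h₁.trans (A.moment_smul η z h₂).symm), A.mul_smul]

/-- Freeness concerns stabilisers only, so it is applied to γ⁻¹γ', which fixes z. -/
lemma eq_of_act_eq (hA : A.IsFree) {γ γ' : G} {z : Z} (h : 𝓖.s γ = A.moment z)
    (h' : 𝓖.s γ' = A.moment z) (e : A.act γ z = A.act γ' z) : γ = γ' := by
  have hr : 𝓖.r γ = 𝓖.r γ' := by rw [← moment_act h, ← moment_act h', e]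
  have h₁ : 𝓖.s (𝓖.inv γ) = 𝓖.r γ' := (𝓖.s_inv γ).trans hr
  have h₂ : A.act (𝓖.m (𝓖.inv γ) γ') z = z := by
    rw [m_act h₁ h', ← e, ← m_act (𝓖.s_inv γ) h, 𝓖.inv_m, h, unit_act]
  have h₃ : 𝓖.s (𝓖.m (𝓖.inv γ) γ') = A.moment z := by rw [𝓖.s_m h₁, h']
  rw [act_eq h₃] at h₂
  have h₄ := congrArg (𝓖.m γ) (hA _ _ _ h₂)
  rw [← 𝓖.m_assoc (𝓖.r_inv γ).symm h₁, 𝓖.m_inv, 𝓖.unit_m hr.symm, 𝓖.m_unit h] at h₄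
  exact h₄.symm

lemma continuousOn_act :
    ContinuousOn (fun p : G × Z => A.act p.1 p.2) {p | 𝓖.s p.1 = A.moment p.2} := by
  rw [continuousOn_iff_continuous_domRestrict]
  exact A.continuous_smul.congr fun p => (act_eq p.2).symm

/-- For a free and proper action, `γ` depends continuously on `γ · z` and `z`. -/
lemma eventually_mem_of_act [T2Space Z] [LocallyCompactSpace Z] (hf : A.IsFree) (hp : A.IsProper)
    {γ : G} {z : Z} (h : 𝓖.s γ = A.moment z) {O : Set G} (hO : O ∈ 𝓝 γ) :
    ∀ᶠ q : Z × Z in 𝓝 (A.act γ z, z), ∀ γ', 𝓖.s γ' = A.moment q.2 → A.act γ' q.2 = q.1 →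
      γ' ∈ O := by
  let θ : {p : G × Z // 𝓖.s p.1 = A.moment p.2} → Z × Z :=
    fun p => (A.smul p.1.1 p.1.2 p.2, p.1.2)
  -- Since Z × Z is locally compact Hausdorff, compact preimages make θ proper, hence closed; with
  -- freeness it is a closed embedding, so neighbourhoods of (γ, z) are pulled back from
  -- neighbourhoods of (γ·z, z).
  have hθ : IsProperMap θ := isProperMap_iff_isCompact_preimage.2
    ⟨A.continuous_smul.prodMk (by fun_prop), fun K hK => hp K hK⟩
  have hi : Function.Injective θ := by
    rintro ⟨⟨γ₁, z₁⟩, h₁⟩ ⟨⟨γ₂, z₂⟩, h₂⟩ e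
    obtain rfl : z₁ = z₂ := congrArg Prod.snd e
    have e₁ : A.smul γ₁ z₁ h₁ = A.smul γ₂ z₁ h₂ := congrArg Prod.fst e
    obtain rfl : γ₁ = γ₂ := eq_of_act_eq hf h₁ h₂ (by rw [act_eq h₁, act_eq h₂, e₁])
    rfl
  have he := IsClosedEmbedding.of_continuous_injective_isClosedMap hθ.continuous hi hθ.isClosedMap
  have hn : (fun p : {p : G × Z // 𝓖.s p.1 = A.moment p.2} => p.1.1) ⁻¹' O ∈
      𝓝 (⟨(γ, z), h⟩ : {p : G × Z // 𝓖.s p.1 = A.moment p.2}) :=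
    ContinuousAt.preimage_mem_nhds (by fun_prop) hO
  rw [he.isInducing.nhds_eq_comap, mem_comap] at hn
  obtain ⟨W, hW, hWO⟩ := hn
  rw [act_eq h]
  filter_upwards [hW] with q hq γ' h' e
  refine @hWO ⟨(γ', q.2), h'⟩ ?_
  rw [act_eq h'] at e
  change (A.smul γ' q.2 h', q.2) ∈ W
  rwa [e]

end LeftAction

namespace RightAction

variable {H : Type u₁} {V : Type u₂} [TopologicalSpace H] [TopologicalSpace V]
  {𝓗 : TopologicalGroupoid H V} {Z : Type u₅} [TopologicalSpace Z] (A : RightAction 𝓗 Z)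

open Classical in
/-- The action extended to a total operation. -/
noncomputable def act (z : Z) (η : H) : Z := if h : A.moment z = 𝓗.r η then A.smul z η h else z

variable {A}

lemma act_eq {z : Z} {η : H} (h : A.moment z = 𝓗.r η) : A.act z η = A.smul z η h := dif_pos h

lemma moment_act {z : Z} {η : H} (h : A.moment z = 𝓗.r η) : A.moment (A.act z η) = 𝓗.s η := by
  rw [act_eq h, A.moment_smul]

lemma act_unit (z : Z) : A.act z (𝓗.unit (A.moment z)) = z := by
  rw [act_eq (𝓗.r_unit _).symm, A.smul_unit]

lemma act_m {z : Z} {η ζ : H} (h₁ : A.moment z = 𝓗.r η) (h₂ : 𝓗.s η = 𝓗.r ζ) :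
    A.act z (𝓗.m η ζ) = A.act (A.act z η) ζ := by
  rw [𝓗.m_eq h₂, act_eq h₁, act_eq (h₁.trans (𝓗.r_mul η ζ h₂).symm),
    act_eq ((A.moment_smul z η h₁).trans h₂), A.smul_mul]

lemma eq_of_act_eq (hA : A.IsFree) {η η' : H} {z : Z} (h : A.moment z = 𝓗.r η)
    (h' : A.moment z = 𝓗.r η') (e : A.act z η = A.act z η') : η = η' := by
  have hs : 𝓗.s η = 𝓗.s η' := by rw [← moment_act h, ← moment_act h', e]
  have h₁ : 𝓗.s η = 𝓗.r (𝓗.inv η') := hs.trans (𝓗.r_inv η').symm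
  have h₂ : A.act z (𝓗.m η (𝓗.inv η')) = z := by
    rw [act_m h h₁, e, ← act_m h' (𝓗.r_inv η').symm, 𝓗.m_inv, ← h', act_unit]
  have h₃ : A.moment z = 𝓗.r (𝓗.m η (𝓗.inv η')) := by rw [𝓗.r_m h₁, h]
  rw [act_eq h₃] at h₂
  have h₄ := congrArg (fun ζ => 𝓗.m ζ η') (hA _ _ _ h₂)
  rwa [𝓗.m_assoc h₁ (𝓗.s_inv η'), 𝓗.inv_m, 𝓗.unit_m h'.symm, 𝓗.m_unit hs] at h₄

lemma continuousOn_act :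
    ContinuousOn (fun p : Z × H => A.act p.1 p.2) {p | A.moment p.1 = 𝓗.r p.2} := by
  rw [continuousOn_iff_continuous_domRestrict]
  exact A.continuous_smul.congr fun p => (act_eq p.2).symm

/-- For a free and proper action, `η` depends continuously on `z · η` and `z`. -/
lemma eventually_mem_of_act [T2Space Z] [LocallyCompactSpace Z] (hf : A.IsFree) (hp : A.IsProper)
    {η : H} {z : Z} (h : A.moment z = 𝓗.r η) {O : Set H} (hO : O ∈ 𝓝 η) :
    ∀ᶠ q : Z × Z in 𝓝 (A.act z η, z), ∀ η', A.moment q.2 = 𝓗.r η' → A.act q.2 η' = q.1 →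
      η' ∈ O := by
  let θ : {p : Z × H // A.moment p.1 = 𝓗.r p.2} → Z × Z :=
    fun p => (A.smul p.1.1 p.1.2 p.2, p.1.1)
  have hθ : IsProperMap θ := isProperMap_iff_isCompact_preimage.2
    ⟨A.continuous_smul.prodMk (by fun_prop), fun K hK => hp K hK⟩
  have hi : Function.Injective θ := by
    rintro ⟨⟨z₁, η₁⟩, h₁⟩ ⟨⟨z₂, η₂⟩, h₂⟩ e
    obtain rfl : z₁ = z₂ := congrArg Prod.snd e
    have e₁ : A.smul z₁ η₁ h₁ = A.smul z₁ η₂ h₂ := congrArg Prod.fst e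
    obtain rfl : η₁ = η₂ := eq_of_act_eq hf h₁ h₂ (by rw [act_eq h₁, act_eq h₂, e₁])
    rfl
  have he := IsClosedEmbedding.of_continuous_injective_isClosedMap hθ.continuous hi hθ.isClosedMap
  have hn : (fun p : {p : Z × H // A.moment p.1 = 𝓗.r p.2} => p.1.2) ⁻¹' O ∈
      𝓝 (⟨(z, η), h⟩ : {p : Z × H // A.moment p.1 = 𝓗.r p.2}) :=
    ContinuousAt.preimage_mem_nhds (by fun_prop) hO
  rw [he.isInducing.nhds_eq_comap, mem_comap] at hn
  obtain ⟨W, hW, hWO⟩ := hn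
  rw [act_eq h]
  filter_upwards [hW] with q hq η' h' e
  refine @hWO ⟨(q.2, η'), h'⟩ ?_
  rw [act_eq h'] at e
  change (A.smul q.2 η' h', q.2) ∈ W
  rwa [e]

end RightAction

/-! ### Equivalences give isomorphic blow-ups. -/

namespace GroupoidEquivalence

variable {G : Type u₁} {U : Type u₂} {H : Type u₃} {V : Type u₄}
  [TopologicalSpace G] [TopologicalSpace U] [TopologicalSpace H] [TopologicalSpace V]
  {𝓖 : TopologicalGroupoid G U} {𝓗 : TopologicalGroupoid H V}
  {Z : Type u₅} [TopologicalSpace Z] (E : GroupoidEquivalence 𝓖 𝓗 Z)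

lemma left_moment_act {z : Z} {η : H} (h : E.right.moment z = 𝓗.r η) :
    E.left.moment (E.right.act z η) = E.left.moment z := by
  rw [RightAction.act_eq h, E.left_moment_right_smul]

lemma right_moment_act {z : Z} {γ : G} (h : 𝓖.s γ = E.left.moment z) :
    E.right.moment (E.left.act γ z) = E.right.moment z := by
  rw [LeftAction.act_eq h, E.right_moment_left_smul]

lemma act_comm {γ : G} {z : Z} {η : H} (h₁ : 𝓖.s γ = E.left.moment z)
    (h₂ : E.right.moment z = 𝓗.r η) :
    E.right.act (E.left.act γ z) η = E.left.act γ (E.right.act z η) := by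
  rw [LeftAction.act_eq h₁, RightAction.act_eq h₂,
    RightAction.act_eq ((E.right_moment_left_smul γ z h₁).trans h₂),
    LeftAction.act_eq (h₁.trans (E.left_moment_right_smul z η h₂).symm), E.smul_comm]

lemma surjective_left_moment : Function.Surjective E.left.moment := by
  obtain ⟨φ, hφ⟩ := E.left_moment_homeo
  intro u
  obtain ⟨x, rfl⟩ := φ.surjective u
  obtain ⟨z, rfl⟩ := Quotient.exists_rep x
  exact ⟨z, (hφ z).symm⟩

lemma surjective_right_moment : Function.Surjective E.right.moment := by
  obtain ⟨φ, hφ⟩ := E.right_moment_homeo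
  intro u
  obtain ⟨x, rfl⟩ := φ.surjective u
  obtain ⟨z, rfl⟩ := Quotient.exists_rep x
  exact ⟨z, (hφ z).symm⟩

/-- Injectivity of the induced map on Z / H says that H is transitive on the fibres of the left
moment map. -/
lemma exists_right_act {z w : Z} (h : E.left.moment z = E.left.moment w) :
    ∃ η, E.right.moment w = 𝓗.r η ∧ E.right.act w η = z := by
  obtain ⟨φ, hφ⟩ := E.left_moment_homeo
  rw [← hφ, ← hφ] at h
  obtain ⟨η, hη, e⟩ := Quotient.exact (φ.injective h)
  exact ⟨η, hη, by rw [RightAction.act_eq hη, e]⟩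

lemma exists_left_act {z w : Z} (h : E.right.moment z = E.right.moment w) :
    ∃ γ, 𝓖.s γ = E.left.moment w ∧ E.left.act γ w = z := by
  obtain ⟨φ, hφ⟩ := E.right_moment_homeo
  rw [← hφ, ← hφ] at h
  obtain ⟨γ, hγ, e⟩ := Quotient.exact (φ.injective h)
  exact ⟨γ, hγ, by rw [LeftAction.act_eq hγ, e]⟩

/-- The blow-ups of equivalent groupoids along the moment maps of an equivalence are isomorphic:
`(z, γ, w)` corresponds to `(z, η, w)` when `γ · w = z · η`. -/
def blowUpIso [T2Space Z] [LocallyCompactSpace Z] :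
    TopologicalGroupoid.BlowUpIso 𝓖 𝓗 Z where
  a := E.left.moment
  b := E.right.moment
  continuous_a := E.left.continuous_moment
  continuous_b := E.right.continuous_moment
  isOpenMap_a := E.isOpenMap_left_moment
  isOpenMap_b := E.isOpenMap_right_moment
  surjective_a := E.surjective_left_moment
  surjective_b := E.surjective_right_moment
  link z w γ η := (𝓖.r γ = E.left.moment z ∧ 𝓖.s γ = E.left.moment w) ∧
    (𝓗.r η = E.right.moment z ∧ 𝓗.s η = E.right.moment w) ∧ E.left.act γ w = E.right.act z η
  r_left := fun h => h.1.1
  s_left := fun h => h.1.2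
  r_right := fun h => h.2.1.1
  s_right := fun h => h.2.1.2
  exists_right := by
    intro z w γ h₁ h₂
    -- Both γ·w and z lie over r(γ), so some η carries z to γ·w.
    obtain ⟨η, hη, e⟩ := E.exists_right_act (z := E.left.act γ w) (w := z)
      ((LeftAction.moment_act h₂).trans h₁)
    refine ⟨η, ⟨h₁, h₂⟩, ⟨hη.symm, ?_⟩, e.symm⟩
    rw [← RightAction.moment_act hη, e, E.right_moment_act h₂]
  exists_left := by
    intro z w η h₁ h₂
    obtain ⟨γ, hγ, e⟩ := E.exists_left_act (z := E.right.act z η) (w := w)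
      ((RightAction.moment_act h₁.symm).trans h₂)
    refine ⟨γ, ⟨?_, hγ⟩, ⟨h₁, h₂⟩, e⟩
    rw [← LeftAction.moment_act hγ, e, E.left_moment_act h₁.symm]
  unique_right := fun h h' => RightAction.eq_of_act_eq E.right_free h.2.1.1.symm h'.2.1.1.symm
    (h.2.2.symm.trans h'.2.2)
  unique_left := fun h h' => LeftAction.eq_of_act_eq E.left_free h.1.2 h'.1.2
    (h.2.2.trans h'.2.2.symm)
  link_m := by
    rintro z w v γ η γ' η' ⟨⟨h₁, h₂⟩, ⟨h₃, h₄⟩, e⟩ ⟨⟨h₁', h₂'⟩, ⟨h₃', h₄'⟩, e'⟩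
    have hγ : 𝓖.s γ = 𝓖.r γ' := h₂.trans h₁'.symm
    have hη : 𝓗.s η = 𝓗.r η' := h₄.trans h₃'.symm
    refine ⟨⟨(𝓖.r_m hγ).trans h₁, (𝓖.s_m hγ).trans h₂'⟩,
      ⟨(𝓗.r_m hη).trans h₃, (𝓗.s_m hη).trans h₄'⟩, ?_⟩
    -- (γγ')·v = γ·(w·η') = (γ·w)·η' = z·(ηη').
    rw [LeftAction.m_act hγ h₂', RightAction.act_m h₃.symm hη, e', ← e,
      E.act_comm h₂ h₃'.symm]
  eventually_right := by
    rintro z w γ η ⟨⟨h₁, h₂⟩, ⟨h₃, h₄⟩, e⟩ O hO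
    have hev := RightAction.eventually_mem_of_act E.right_free E.right_proper h₃.symm hO
    rw [← e] at hev
    -- The total action is continuous only on composable pairs, hence the restricted filter; off
    -- that set there is no link and nothing to prove.
    have hc : Tendsto (fun p : Z × Z × G => (E.left.act p.2.2 p.2.1, p.1))
        (𝓝[{p | 𝓖.s p.2.2 = E.left.moment p.2.1}] (z, w, γ)) (𝓝 (E.left.act γ w, z)) := by
      have h : ContinuousOn (fun p : Z × Z × G => (E.left.act p.2.2 p.2.1, p.1))
          {p | 𝓖.s p.2.2 = E.left.moment p.2.1} :=
        (LeftAction.continuousOn_act.comp (f := fun p : Z × Z × G => (p.2.2, p.2.1))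
          (by fun_prop) fun _ hp => hp).prodMk (by fun_prop)
      exact h (z, w, γ) h₂
    filter_upwards [eventually_nhdsWithin_iff.1 (hc.eventually hev)] with p hp η' hl
    exact hp hl.1.2 η' hl.2.1.1.symm hl.2.2.symm
  eventually_left := by
    rintro z w γ η ⟨⟨h₁, h₂⟩, ⟨h₃, h₄⟩, e⟩ O hO
    have hev := LeftAction.eventually_mem_of_act E.left_free E.left_proper h₂ hO
    rw [e] at hev
    have hc : Tendsto (fun p : Z × Z × H => (E.right.act p.1 p.2.2, p.2.1))
        (𝓝[{p | E.right.moment p.1 = 𝓗.r p.2.2}] (z, w, η)) (𝓝 (E.right.act z η, w)) := by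
      have h : ContinuousOn (fun p : Z × Z × H => (E.right.act p.1 p.2.2, p.2.1))
          {p | E.right.moment p.1 = 𝓗.r p.2.2} :=
        (RightAction.continuousOn_act.comp (f := fun p : Z × Z × H => (p.1, p.2.2))
          (by fun_prop) fun _ hp => hp).prodMk (by fun_prop)
      exact h (z, w, η) h₃.symm
    filter_upwards [eventually_nhdsWithin_iff.1 (hc.eventually hev)] with p hp γ' hl
    exact hp hl.2.1.1.symm γ' hl.1.2 hl.2.2

end GroupoidEquivalence

theorem mainTheorem6
    {G : Type u₁} {U : Type u₂} {H : Type u₃} {V : Type u₄}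
    [TopologicalSpace G] [TopologicalSpace U] [TopologicalSpace H] [TopologicalSpace V]
    [LocallyCompactSpace G] [T2Space G] [LocallyCompactSpace H] [T2Space H]
    (𝓖 : TopologicalGroupoid G U) (𝓗 : TopologicalGroupoid H V)
    (hGr : IsOpenMap 𝓖.r) (hGs : IsOpenMap 𝓖.s)
    (hHr : IsOpenMap 𝓗.r) (hHs : IsOpenMap 𝓗.s) :
    (TopologicalGroupoid.Equivalent.{u₁, u₂, u₃, u₄, u₅} 𝓖 𝓗 →
      (𝓖.IsProperModuloIsotropy ↔ 𝓗.IsProperModuloIsotropy)) ∧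
    (𝓖.HasAbelianIsotropy →
      ∀ (X : Type u₆) [TopologicalSpace X] [LocallyCompactSpace X] [T2Space X]
        (f : X → U) (hf : Continuous f), IsOpenMap f → Function.Surjective f →
        (𝓖.RActsContinuously ↔ (𝓖.blowUp f hf).RActsContinuously)) := by
  constructor
  · rintro ⟨Z, _, _, _, ⟨E⟩⟩
    exact ⟨E.blowUpIso.isProperModuloIsotropy, E.blowUpIso.swap.isProperModuloIsotropy⟩
  · intro _ X _ _ _ f hf ho hs
    have := 𝓖.locallyCompactSpace_blowUp hf
    have E := 𝓖.blowUpIsoBlowUp hf ho hs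
    exact ⟨E.rActsContinuously, E.swap.rActsContinuously⟩
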